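/- **Setting.** Let $\mathcal I$ be a finite set of cells, $J\ge 1$, $S_1,\dots,S_J$ non-empty subsets of $\mathcal I$, and let $\mathbf A=(a_{ji})$ be the $J\times|\mathcal I|$ matrix with $a_{ji}=1$ if $i\in S_j$ and $a_{ji}=0$ otherwise; $A_j$ is its $j$-th row. Let $\mathbf D$ be an integer matrix whose rows form a basis of $\operatorname{Ker}\mathbf A$. The parameter $\boldsymbol\delta=(\delta(i))_{i\in\mathcal I}$ is either a vector of intensities ($\delta(i)>0$) or a vector of probabilities ($\delta(i)>0$, $\sum_i\delta(i)=1$); the relational model generated by $\mathbf A$ is the set of such $\boldsymbol\delta$ with $\log\boldsymbol\delta=\mathbf A'\boldsymbol\beta$ for some $\boldsymbol\beta\in\mathbb R^J$. Let $\boldsymbol y\in\mathbb Z_{\ge0}^{\mathcal I}$, $\boldsymbol y\neq \boldsymbol 0$, be observed counts, with likelihood $\prod_i e^{-\delta(i)}\delta(i)^{y(i)}/y(i)!$ for intensities (independent Poisson counts) and $\frac{N!}{\prod_i y(i)!}\prod_i\delta(i)^{y(i)}$, $N=\sum_i y(i)$, for probabilities (multinomial counts). Put $\boldsymbol q=\boldsymbol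 y$ for intensities and $\boldsymbol q=\boldsymbol y/N$ for probabilities. A maximum likelihood estimate (MLE) is a maximizer of the likelihood over the model. Write $\boldsymbol 1\boldsymbol\delta=\sum_i\delta(i)$ and $\boldsymbol 1\mathbf A\boldsymbol q=\sum_j A_j\boldsymbol q$. **IPF($\gamma,\eta$).** Start with $d=0$, $\delta^{(0)}(i)=1$ for all $i$ and $\theta^{(0)}(j)=1$ for all $j$. Take $j\in\{1,\dots,J\}$ with $d+1\equiv j \bmod J$ and set $$\delta^{(d+1)}(i)=\delta^{(d)}(i)\Big(\gamma\frac{A_j\boldsymbol q}{A_j\boldsymbol\delta^{(d)}}\Big)^{a_{ji}}\ (i\in\mathcal I),\qquad \theta^{(d+1)}(j)=\theta^{(d)}(j)\frac{\delta^{(d+1)}(i_j^*)}{\delta^{(d)}(i_j^*)},$$ where $i^*_j\in S_j$ is a fixed cell, the other $\theta(l)$ being unchanged. If $|\gamma A_l\boldsymbol q-A_l\boldsymbol\delta^{(d+1)}|<\eta$ for all $l=1,\dots,J$, return $\boldsymbol\delta^{(d+1)}$; otherwise increase $d$ by one and repeat. **G-IPF($\varepsilon$).** For intensities, return the result of IPF($1,\varepsilon$)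 and $\hat\gamma_\varepsilon=1$. For probabilities, compute $\boldsymbol p^*$ using IPF($1,\varepsilon$); if $|\boldsymbol 1\boldsymbol p^*-1|<\varepsilon$, return $\boldsymbol p^*$ and $\hat\gamma_\varepsilon=1$. Otherwise let $\gamma_L=(\boldsymbol 1\mathbf A\boldsymbol q)^{-1}$, $\gamma_R=\min_j 1/A_j\boldsymbol q$. For $T=1,2,3,\dots$ in turn, and for $t=0,1,\dots,T$ in turn, let $\gamma_t=\gamma_L+\frac tT(\gamma_R-\gamma_L)$ and compute $\boldsymbol p^*_{\gamma_t}$ using IPF($\gamma_t,\varepsilon/T$); as soon as $|\boldsymbol 1\boldsymbol p^*_{\gamma_t}-1|<\varepsilon$, return $\boldsymbol p^*_{\gamma_t}$ and $\hat\gamma_\varepsilon=\gamma_t$. **Theorem.** Assume that the MLE of $\boldsymbol\delta$ under the relational model generated by $\mathbf A$ exists and is unique. Then for every $\varepsilon>0$ and every choice of the cells $i^*_j\in S_j$, G-IPF($\varepsilon$) terminates after finitely many steps, and its output $(\hat{\boldsymbol\delta}_\varepsilon,\hat\gamma_\varepsilon)$ satisfies $\hat\delta_\varepsilon(i)>0$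 for all $i$ and $$|A_j\hat{\boldsymbol\delta}_\varepsilon-\hat\gamma_\varepsilon A_j\boldsymbol q|<\varepsilon\ \ (j=1,\dots,J),\qquad \mathbf D\log\hat{\boldsymbol\delta}_\varepsilon=\boldsymbol 0,$$ and, in the case of probabilities, also $|\boldsymbol 1\hat{\boldsymbol\delta}_\varepsilon-1|<\varepsilon$. If the stopping test of IPF($\gamma,\eta$) is relaxed to $|\gamma A_l\boldsymbol q-A_l\boldsymbol\delta^{(d+1)}|\le\eta$ for all $l$, the same holds with $\le\varepsilon$ in place of $<\varepsilon$ in the first displayed inequality. -/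

import Mathlib

open scoped Matrix

noncomputable section

namespace RelationalModel

variable {I : Type*} [Fintype I] [DecidableEq I] {J : ℕ}

/-- Whether the population is parameterized by cell intensities (Poisson sampling) or by cell
probabilities (multinomial sampling). -/
inductive Kind where
  | intensity
  | probability

/-- The model matrix: its rows are the indicators of the generating subsets. -/
def modelMatrix (S : Fin J → Finset I) : Matrix (Fin J) I ℝ :=
  fun j i => if i ∈ S j then 1 else 0

/-- The positive parameter vectors on the table: arbitrary positive intensities, or positive
probabilities with total one. -/
def parameterSet (I : Type*) [Fintype I] : Kind → Set (I → ℝ)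
  | .intensity => {δ | ∀ i, 0 < δ i}
  | .probability => {δ | (∀ i, 0 < δ i) ∧ ∑ i, δ i = 1}

/-- The relational model with model matrix `A`: the `δ` with `log δ = A' β` for some `β`. -/
def model (kind : Kind) (A : Matrix (Fin J) I ℝ) : Set (I → ℝ) :=
  {δ | δ ∈ parameterSet I kind ∧ ∃ β : Fin J → ℝ, (fun i => Real.log (δ i)) = Aᵀ *ᵥ β}

/-- The likelihood of the observed table of counts `y`: independent Poisson counts with means
`δ i`, or multinomial counts with `∑ i, y i` trials and cell probabilities `δ i`. -/
def likelihood (kind : Kind) (y : I → ℕ) (δ : I → ℝ) : ℝ :=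
  match kind with
  | .intensity => ∏ i, (Real.exp (-δ i) * δ i ^ y i / ((y i).factorial : ℝ))
  | .probability => (Nat.multinomial Finset.univ y : ℝ) * ∏ i, δ i ^ y i

/-- `δ` is a maximum likelihood estimate under the model, given the counts `y`. -/
def IsMLE (kind : Kind) (A : Matrix (Fin J) I ℝ) (y : I → ℕ) (δ : I → ℝ) : Prop :=
  δ ∈ model kind A ∧ ∀ δ' ∈ model kind A, likelihood kind y δ' ≤ likelihood kind y δ

/-- The observed vector: `q = y` for intensities, `q = y / (1 y)` for probabilities. -/
def observed (kind : Kind) (y : I → ℕ) : I → ℝ :=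
  match kind with
  | .intensity => fun i => (y i : ℝ)
  | .probability => fun i => (y i : ℝ) / ∑ k, (y k : ℝ)

/-- `D` is an integer kernel basis matrix of `A`: its rows form a basis of the kernel of `A`. -/
structure IsKernelBasisMatrix {k : ℕ} (D : Matrix (Fin k) I ℤ) (A : Matrix (Fin J) I ℝ) :
    Prop where
  linearIndependent : LinearIndependent ℝ (fun r : Fin k => (fun i => (D r i : ℝ)))
  span_eq : Submodule.span ℝ (Set.range (fun r : Fin k => (fun i => (D r i : ℝ)))) =
    LinearMap.ker A.mulVecLin

/-! ### The procedure IPF(γ, η) -/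

/-- The variables of iterative proportional fitting: the iteration counter `d`, the current cell
parameters and the current multiplicative model parameters. -/
structure IPFState (I : Type*) (J : ℕ) where
  d : ℕ
  δ : I → ℝ
  θ : Fin J → ℝ

/-- Initial values: `d = 0` and all cell and model parameters equal to one. -/
def ipfInit (I : Type*) (J : ℕ) : IPFState I J := ⟨0, fun _ => 1, fun _ => 1⟩

/-- Cell update for the subset `j`: `δ i` is multiplied by `(γ A_j q / A_j δ) ^ a_{ji}`. -/
def cellUpdate (A : Matrix (Fin J) I ℝ) (q : I → ℝ) (γ : ℝ) (j : Fin J) (δ : I → ℝ) : I → ℝ :=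
  fun i => δ i * (γ * ((A *ᵥ q) j / (A *ᵥ δ) j)) ^ (A j i)

/-- One iteration: the subsets are visited cyclically (`j = d mod J` when the subsets are numbered
from zero); `iStar j` is the cell of the `j`-th subset through which `θ j` is updated. -/
def ipfIterate [NeZero J] (A : Matrix (Fin J) I ℝ) (iStar : Fin J → I) (q : I → ℝ) (γ : ℝ)
    (s : IPFState I J) : IPFState I J :=
  let j : Fin J := Fin.ofNat J s.d
  let δ' := cellUpdate A q γ j s.δ
  ⟨s.d + 1, δ', Function.update s.θ j (s.θ j * (δ' (iStar j) / s.δ (iStar j)))⟩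

/-- The stopping test with tolerance `η`: every subset sum of `δ` is within `η` of the target.
The relation `rel` is `<` or `≤` and says what "within" means. -/
def ipfAccept (rel : ℝ → ℝ → Prop) (A : Matrix (Fin J) I ℝ) (q : I → ℝ) (γ η : ℝ)
    (δ : I → ℝ) : Prop :=
  ∀ j, rel |γ * (A *ᵥ q) j - (A *ᵥ δ) j| η

/-! ### The algorithm G-IPF(ε), as a deterministic machine -/

/-- Lower end of the search segment, `(1 A q)⁻¹`. -/
def gammaL (A : Matrix (Fin J) I ℝ) (q : I → ℝ) : ℝ := (∑ j, (A *ᵥ q) j)⁻¹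

/-- Upper end of the search segment, the minimum of `1 / A_j q` over `j`. -/
def gammaR (A : Matrix (Fin J) I ℝ) (q : I → ℝ) : ℝ := ⨅ j, 1 / (A *ᵥ q) j

/-- The grid point `γ_t = γ_L + (t / T) (γ_R - γ_L)`. -/
def gridPoint (A : Matrix (Fin J) I ℝ) (q : I → ℝ) (T t : ℕ) : ℝ :=
  gammaL A q + (t : ℝ) / (T : ℝ) * (gammaR A q - gammaL A q)

/-- Configurations of G-IPF(ε): executing the initial call IPF(1, ε); executing, for the current
`T` and `t`, the call IPF(γ_t, ε / T); or finished with output `δ`, `γ`. -/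
inductive Config (I : Type*) (J : ℕ) where
  | initial (s : IPFState I J)
  | grid (T t : ℕ) (s : IPFState I J)
  | finished (δ : I → ℝ) (γ : ℝ)

open Classical in
/-- One step of G-IPF(ε): one iteration of the current call of IPF, followed by its stopping test
and, when that call returns, by the control instructions of G-IPF(ε) up to the next call. -/
def gipfStep [NeZero J] (rel : ℝ → ℝ → Prop) (kind : Kind) (A : Matrix (Fin J) I ℝ)
    (iStar : Fin J → I) (q : I → ℝ) (ε : ℝ) : Config I J → Config I J
  | .initial s =>
      let s' := ipfIterate A iStar q 1 s
      if ipfAccept rel A q 1 ε s'.δ then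
        match kind with
        | .intensity => .finished s'.δ 1
        | .probability =>
            if |∑ i, s'.δ i - 1| < ε then .finished s'.δ 1 else .grid 1 0 (ipfInit I J)
      else .initial s'
  | .grid T t s =>
      let s' := ipfIterate A iStar q (gridPoint A q T t) s
      if ipfAccept rel A q (gridPoint A q T t) (ε / T) s'.δ then
        if |∑ i, s'.δ i - 1| < ε then .finished s'.δ (gridPoint A q T t)
        else if t < T then .grid T (t + 1) (ipfInit I J)
        else .grid (T + 1) 0 (ipfInit I J)
      else .grid T t s'
  | .finished δ γ => .finished δ γ

/-- G-IPF(ε) terminates, after finitely many steps, with output `δ`, `γ`. -/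
def GIPFReturns [NeZero J] (rel : ℝ → ℝ → Prop) (kind : Kind) (A : Matrix (Fin J) I ℝ)
    (iStar : Fin J → I) (q : I → ℝ) (ε : ℝ) (δ : I → ℝ) (γ : ℝ) : Prop :=
  ∃ n : ℕ, (gipfStep rel kind A iStar q ε)^[n] (.initial (ipfInit I J)) = .finished δ γ

end RelationalModel

end

open scoped Matrix

noncomputable section

open Filter Topology

namespace RelationalModel

/-! ### The model and iterative proportional fitting -/

section Fitting

variable {I : Type*} [Fintype I] {J : ℕ}

/-! An MLE supplies a positive model member `p` with `A p = c A q`, `c > 0`, by the likelihood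
equations (`IsMLE.exists_proportional`). Scaling `p` gives, for every `γ > 0`, a positive vector
`δ₀` with subset sums `γ A q`; it may leave the model, but IPF needs only its positivity.

Against `δ₀`, a fitting step that moves a subset sum from `s` to `t` raises the Kullback-Leibler
potential by `t log (t/s) - t + s ≥ (√t - √s)²`. The potential is bounded above, so the gains tend
to zero. Hence the sums about to be fitted approach their targets, the moves within a cycle die out,
and at the ends of cycles all sums are nearly correct: the stopping test passes (`ipf_accepts`).
Convergence of the iterates is not needed. They stay in the model, so `D log δ = 0`.

For probabilities, `c` lies in `[γ_L, γ_R]`. For large `T` some grid point is close to `c` and the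
tolerance `ε / T` is small, so an accepted vector has nearly the subset sums of `p`. Model members
with nearly those sums have nearly the same total (`exists_abs_sum_sub_lt`, by compactness and
uniqueness on the closure of the model), so the search stops by then. An earlier stop is also valid,
since the tests themselves give the required bounds. -/

lemma sum_log_mul_eq {A : Matrix (Fin J) I ℝ} {δ : I → ℝ} {β : Fin J → ℝ}
    (h : (fun i => Real.log (δ i)) = Aᵀ *ᵥ β) (v : I → ℝ) :
    ∑ i, v i * Real.log (δ i) = ∑ j, β j * (A *ᵥ v) j := by
  have h1 : ∑ i, v i * Real.log (δ i) = v ⬝ᵥ (Aᵀ *ᵥ β) := by rw [← h]; rfl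
  rw [h1, Matrix.mulVec_transpose, dotProduct_comm, ← Matrix.dotProduct_mulVec]
  rfl

lemma mul_exp_mem_model {A : Matrix (Fin J) I ℝ} {δ : I → ℝ}
    (h : δ ∈ model .intensity A) (v : Fin J → ℝ) :
    (fun i => δ i * Real.exp ((Aᵀ *ᵥ v) i)) ∈ model .intensity A := by
  obtain ⟨h0, β, hβ⟩ := h
  refine ⟨fun i => mul_pos (h0 i) (Real.exp_pos _), β + v, ?_⟩
  rw [Matrix.mulVec_add, ← hβ]
  funext i
  simp only [Pi.add_apply]
  rw [Real.log_mul (h0 i).ne' (Real.exp_pos _).ne', Real.log_exp]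

lemma one_mem_model (A : Matrix (Fin J) I ℝ) : (fun _ => (1 : ℝ)) ∈ model .intensity A :=
  ⟨fun _ => one_pos, 0, by funext i; simp⟩

lemma kernel_log_eq_zero {k : ℕ} {D : Matrix (Fin k) I ℤ} {A : Matrix (Fin J) I ℝ}
    (hD : IsKernelBasisMatrix D A) {δ : I → ℝ} (hδ : δ ∈ model .intensity A) :
    D.map (Int.cast : ℤ → ℝ) *ᵥ (fun i => Real.log (δ i)) = 0 := by
  obtain ⟨_, β, hβ⟩ := hδ
  funext r
  have hr : (fun i => (D r i : ℝ)) ∈ LinearMap.ker A.mulVecLin := by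
    rw [← hD.span_eq]
    exact Submodule.subset_span ⟨r, rfl⟩
  have hr' : A *ᵥ (fun i => (D r i : ℝ)) = 0 := by simpa using hr
  have := sum_log_mul_eq hβ (fun i => (D r i : ℝ))
  rw [hr'] at this
  simpa [Matrix.mulVec, dotProduct] using this

/-- This is `log x ≤ x - 1` at `x = √s / √t`, multiplied by `2t`. The square root form lets a small
gain force `s` close to `t`. -/
lemma sq_sqrt_sub_sqrt_le {s t : ℝ} (hs : 0 < s) (ht : 0 < t) :
    (√t - √s) ^ 2 ≤ t * Real.log (t / s) - t + s := by
  have h1 : 0 < √s := Real.sqrt_pos.2 hs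
  have h2 : 0 < √t := Real.sqrt_pos.2 ht
  have e1 : √s ^ 2 = s := Real.sq_sqrt hs.le
  have e2 : √t ^ 2 = t := Real.sq_sqrt ht.le
  have h3 : Real.log (t / s) = -(2 * Real.log (√s / √t)) := by
    rw [Real.log_div ht.ne' hs.ne', Real.log_div h1.ne' h2.ne', Real.log_sqrt hs.le,
      Real.log_sqrt ht.le]
    ring
  have h4 := Real.log_le_sub_one_of_pos (div_pos h1 h2)
  have h5 : t * (√s / √t) = √s * √t := by
    field_simp; rw [e2]
  have h6 := mul_le_mul_of_nonneg_left h4 ht.le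
  rw [h3]
  nlinarith

lemma mul_log_sub_le {a x : ℝ} (ha : 0 < a) (hx : 0 < x) :
    a * Real.log x - x ≤ a * Real.log a - a := by
  have h := sq_sqrt_sub_sqrt_le hx ha
  rw [Real.log_div ha.ne' hx.ne'] at h
  nlinarith [sq_nonneg (√a - √x)]

/-- The part of the Kullback-Leibler divergence of `δ` from `δ'` that depends on `δ'`. -/
def divergencePotential (δ δ' : I → ℝ) : ℝ := ∑ i, (δ i * Real.log (δ' i) - δ' i)

lemma divergencePotential_le {δ δ' : I → ℝ} (h : ∀ i, 0 < δ i) (h' : ∀ i, 0 < δ' i) :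
    divergencePotential δ δ' ≤ divergencePotential δ δ :=
  Finset.sum_le_sum fun i _ => mul_log_sub_le (h i) (h' i)

lemma ipfIterate_iterate_d [NeZero J] (A : Matrix (Fin J) I ℝ) (iStar : Fin J → I)
    (q : I → ℝ) (γ : ℝ) (n : ℕ) : ((ipfIterate A iStar q γ)^[n] (ipfInit I J)).d = n := by
  induction n with
  | zero => rfl
  | succ n ih => rw [Function.iterate_succ_apply']; simp [ipfIterate, ih]

lemma ipfIterate_iterate_succ [NeZero J] (A : Matrix (Fin J) I ℝ) (iStar : Fin J → I)
    (q : I → ℝ) (γ : ℝ) (n : ℕ) : ((ipfIterate A iStar q γ)^[n + 1] (ipfInit I J)).δ =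
      cellUpdate A q γ (Fin.ofNat J n) ((ipfIterate A iStar q γ)^[n] (ipfInit I J)).δ := by
  rw [Function.iterate_succ_apply']
  simp [ipfIterate, ipfIterate_iterate_d]

variable [DecidableEq I]

lemma modelMatrix_mulVec (S : Fin J → Finset I) (δ : I → ℝ) (j : Fin J) :
    (modelMatrix S *ᵥ δ) j = ∑ i ∈ S j, δ i := by
  simp [Matrix.mulVec, dotProduct, modelMatrix, Finset.sum_ite_mem]

lemma cellUpdate_apply (S : Fin J → Finset I) (q : I → ℝ) (γ : ℝ) (j : Fin J) (δ : I → ℝ) (i : I) :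
    cellUpdate (modelMatrix S) q γ j δ i =
      if i ∈ S j then
        δ i * (γ * ((modelMatrix S *ᵥ q) j / (modelMatrix S *ᵥ δ) j)) else δ i := by
  by_cases h : i ∈ S j <;> simp [cellUpdate, h, modelMatrix]

/-- The update adds the logarithm of its factor to the `j`-th coordinate of `β`. -/
lemma cellUpdate_mem_model {S : Fin J → Finset I} {q : I → ℝ} {γ : ℝ} {j : Fin J} {δ : I → ℝ}
    (hδ : δ ∈ model .intensity (modelMatrix S))
    (hr : 0 < γ * ((modelMatrix S *ᵥ q) j / (modelMatrix S *ᵥ δ) j)) :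
    cellUpdate (modelMatrix S) q γ j δ ∈ model .intensity (modelMatrix S) := by
  convert mul_exp_mem_model hδ (Pi.single j
    (Real.log (γ * ((modelMatrix S *ᵥ q) j / (modelMatrix S *ᵥ δ) j)))) using 1
  funext i
  rw [cellUpdate_apply, Matrix.mulVec_single]
  by_cases h : i ∈ S j <;> simp [h, modelMatrix, Real.exp_log hr]

/-- Only cells of `S j` change, all by the factor `t / s`, so the gain is exactly `t log (t/s) - t +
s`. -/
lemma divergencePotential_cellUpdate {S : Fin J → Finset I} {q δ₀ δ : I → ℝ} {γ : ℝ} {j : Fin J}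
    (hδ : ∀ i, 0 < δ i) (hs : 0 < (modelMatrix S *ᵥ δ) j) (ht : 0 < (modelMatrix S *ᵥ δ₀) j)
    (hδ₀ : (modelMatrix S *ᵥ δ₀) j = γ * (modelMatrix S *ᵥ q) j) :
    (√((modelMatrix S *ᵥ δ₀) j) - √((modelMatrix S *ᵥ δ) j)) ^ 2 ≤
      divergencePotential δ₀ (cellUpdate (modelMatrix S) q γ j δ) - divergencePotential δ₀ δ := by
  refine (sq_sqrt_sub_sqrt_le hs ht).trans_eq ?_
  set s := (modelMatrix S *ᵥ δ) j with hs'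
  set t := (modelMatrix S *ᵥ δ₀) j with ht'
  have hr : γ * ((modelMatrix S *ᵥ q) j / s) = t / s := by rw [hδ₀]; ring
  have hr0 : 0 < t / s := div_pos ht hs
  have key : ∀ i, (δ₀ i * Real.log (cellUpdate (modelMatrix S) q γ j δ i)
      - cellUpdate (modelMatrix S) q γ j δ i) - (δ₀ i * Real.log (δ i) - δ i) =
      if i ∈ S j then δ₀ i * Real.log (t / s) - δ i * (t / s - 1) else 0 := by
    intro i
    rw [cellUpdate_apply, ← hs', hr]
    split_ifs
    · rw [Real.log_mul (hδ i).ne' hr0.ne']; ring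
    · ring
  rw [divergencePotential, divergencePotential, ← Finset.sum_sub_distrib,
    Finset.sum_congr rfl fun i _ => key i, Finset.sum_ite_mem, Finset.univ_inter,
    Finset.sum_sub_distrib, ← Finset.sum_mul, ← Finset.sum_mul, ← modelMatrix_mulVec,
    ← modelMatrix_mulVec, ← hs', ← ht']
  field_simp
  ring

/-- A cell of `S j` absorbs the share `δ i / s ≤ 1` of the subset's defect; other cells do not move.
-/
lemma abs_cellUpdate_sub_le {S : Fin J → Finset I} {q δ : I → ℝ} {γ : ℝ} {j : Fin J}
    (hδ : ∀ i, 0 < δ i) (hs : 0 < (modelMatrix S *ᵥ δ) j) (i : I) :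
    |cellUpdate (modelMatrix S) q γ j δ i - δ i| ≤
      |γ * (modelMatrix S *ᵥ q) j - (modelMatrix S *ᵥ δ) j| := by
  rw [cellUpdate_apply]
  split_ifs with h
  · set s := (modelMatrix S *ᵥ δ) j with hs'
    have hle : δ i ≤ s := by
      rw [hs', modelMatrix_mulVec]
      exact Finset.single_le_sum (fun k _ => (hδ k).le) h
    have : δ i * (γ * ((modelMatrix S *ᵥ q) j / s)) - δ i =
        δ i / s * (γ * (modelMatrix S *ᵥ q) j - s) := by field_simp
    rw [this, abs_mul, abs_of_pos (div_pos (hδ i) hs)]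
    exact mul_le_of_le_one_left (abs_nonneg _) ((div_le_one hs).2 hle)
  · simp

lemma modelMatrix_mulVec_pos {S : Fin J → Finset I} (hS : ∀ j, (S j).Nonempty) {δ : I → ℝ}
    (hδ : ∀ i, 0 < δ i) (j : Fin J) : 0 < (modelMatrix S *ᵥ δ) j := by
  rw [modelMatrix_mulVec]
  exact Finset.sum_pos (fun i _ => hδ i) (hS j)

lemma mulVec_observed_pos {S : Fin J → Finset I} {q p : I → ℝ} {c : ℝ}
    (hS : ∀ j, (S j).Nonempty) (hp : ∀ i, 0 < p i) (hc : 0 < c)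
    (hAp : modelMatrix S *ᵥ p = c • (modelMatrix S *ᵥ q))
    (j : Fin J) : 0 < (modelMatrix S *ᵥ q) j := by
  have h := modelMatrix_mulVec_pos hS hp j
  rw [hAp] at h
  exact pos_of_mul_pos_right h hc.le

lemma ipfIterate_iterate_mem_model [NeZero J] {S : Fin J → Finset I} (hS : ∀ j, (S j).Nonempty)
    (iStar : Fin J → I) {q : I → ℝ} {γ : ℝ} (hq : ∀ j, 0 < γ * (modelMatrix S *ᵥ q) j) (n : ℕ) :
    ((ipfIterate (modelMatrix S) iStar q γ)^[n] (ipfInit I J)).δ ∈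
      model .intensity (modelMatrix S) := by
  induction n with
  | zero => exact one_mem_model _
  | succ n ih =>
    rw [ipfIterate_iterate_succ]
    refine cellUpdate_mem_model ih ?_
    rw [← mul_div_assoc]
    exact div_pos (hq _) (modelMatrix_mulVec_pos hS ih.1 _)

theorem ipf_accepts [NeZero J] {S : Fin J → Finset I} (hS : ∀ j, (S j).Nonempty)
    (iStar : Fin J → I) {q δ₀ : I → ℝ} {γ η : ℝ} (hη : 0 < η) (hpos : ∀ i, 0 < δ₀ i)
    (hδ₀ : ∀ j, (modelMatrix S *ᵥ δ₀) j = γ * (modelMatrix S *ᵥ q) j) :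
    ∃ n, ipfAccept (· < ·) (modelMatrix S) q γ η
      ((ipfIterate (modelMatrix S) iStar q γ)^[n + 1] (ipfInit I J)).δ := by
  have ht : ∀ j, 0 < (modelMatrix S *ᵥ δ₀) j := modelMatrix_mulVec_pos hS hpos
  set x : ℕ → I → ℝ := fun n => ((ipfIterate (modelMatrix S) iStar q γ)^[n] (ipfInit I J)).δ
    with hx
  have hxpos : ∀ n i, 0 < x n i := fun n =>
    (ipfIterate_iterate_mem_model hS iStar (fun j => (hδ₀ j).symm ▸ ht j) n).1
  have hs : ∀ n j, 0 < (modelMatrix S *ᵥ x n) j := fun n => modelMatrix_mulVec_pos hS (hxpos n)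
  have hstep : ∀ n, x (n + 1) = cellUpdate (modelMatrix S) q γ (Fin.ofNat J n) (x n) :=
    fun n => ipfIterate_iterate_succ _ _ _ _ n
  set V : ℕ → ℝ := fun n => divergencePotential δ₀ (x n) with hV
  have hVstep : ∀ n, (√((modelMatrix S *ᵥ δ₀) (Fin.ofNat J n)) -
      √((modelMatrix S *ᵥ x n) (Fin.ofNat J n))) ^ 2 ≤ V (n + 1) - V n := by
    intro n
    simp only [hV, hstep]
    exact divergencePotential_cellUpdate (hxpos n) (hs n _) (ht _) (hδ₀ _)
  have hmono : Monotone V :=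
    monotone_nat_of_le_succ fun n => sub_nonneg.1 ((sq_nonneg _).trans (hVstep n))
  have hbdd : BddAbove (Set.range V) := by
    refine ⟨divergencePotential δ₀ δ₀, ?_⟩
    rintro _ ⟨n, rfl⟩
    exact divergencePotential_le hpos (hxpos n)
  have hlim := tendsto_atTop_ciSup hmono hbdd
  have hdiff : Tendsto (fun n => V (n + 1) - V n) atTop (𝓝 0) := by
    simpa using (hlim.comp (tendsto_add_atTop_nat 1)).sub hlim
  have hsqrt : Tendsto (fun n => (√((modelMatrix S *ᵥ δ₀) (Fin.ofNat J n)) -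
      √((modelMatrix S *ᵥ x n) (Fin.ofNat J n)))) atTop (𝓝 0) := by
    have h := squeeze_zero (fun n => sq_nonneg _) hVstep hdiff
    have h' := h.sqrt
    simp only [Real.sqrt_sq_eq_abs, Real.sqrt_zero] at h'
    exact (tendsto_zero_iff_abs_tendsto_zero _).2 h'
  -- `hsqrt` controls at time `n` only the subset about to be fitted; along the times `J * m + l`
  -- this is always subset `l`.
  have hblock : ∀ l : ℕ, Tendsto (fun m => J * m + l) atTop atTop := fun l =>
    tendsto_atTop_mono
      (fun m => (Nat.le_mul_of_pos_left m (NeZero.pos J)).trans (Nat.le_add_right _ l)) tendsto_id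
  have hidx : ∀ (l : Fin J) m, Fin.ofNat J (J * m + l) = l := by
    intro l m
    ext
    simp [Fin.ofNat, Nat.mod_eq_of_lt l.2]
  have hsub : ∀ l : Fin J, Tendsto (fun m => (modelMatrix S *ᵥ x (J * m + l)) l) atTop
      (𝓝 ((modelMatrix S *ᵥ δ₀) l)) := by
    intro l
    have h1 := hsqrt.comp (hblock l)
    simp only [Function.comp_def, hidx] at h1
    have h2 := ((tendsto_const_nhds (x := √((modelMatrix S *ᵥ δ₀) l))).sub h1).pow 2
    simpa [Real.sq_sqrt (ht l).le, Real.sq_sqrt (hs _ l).le] using h2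
  -- The sums of different subsets are controlled at different times of a cycle; vanishing moves
  -- transfer them all to its start `J * m`.
  have hxdiff : ∀ l : ℕ, l ≤ J → Tendsto (fun m => x (J * m + l) - x (J * m)) atTop (𝓝 0) := by
    intro l
    induction l with
    | zero => simp
    | succ l ih =>
      intro hl
      have h1 : Tendsto (fun m => x (J * m + l + 1) - x (J * m + l)) atTop (𝓝 0) := by
        rw [tendsto_pi_nhds]
        intro i
        have h2 := (hsub ⟨l, hl⟩).const_sub ((modelMatrix S *ᵥ δ₀) ⟨l, hl⟩)
        rw [sub_self] at h2
        refine squeeze_zero_norm (fun m => ?_) (by simpa using h2.abs)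
        have h3 := abs_cellUpdate_sub_le (q := q) (γ := γ) (hxpos (J * m + l))
          (hs (J * m + l) ⟨l, hl⟩) i
        rw [hδ₀, ← hidx ⟨l, hl⟩ m] at *
        rw [hstep]
        exact h3
      simpa [add_assoc] using h1.add (ih (by omega))
  have hfin : ∀ l : Fin J, Tendsto (fun m => (modelMatrix S *ᵥ x (J * m)) l) atTop
      (𝓝 ((modelMatrix S *ᵥ δ₀) l)) := by
    intro l
    have h1 : Continuous fun v : I → ℝ => (modelMatrix S *ᵥ v) l := by
      simp only [modelMatrix_mulVec]; fun_prop
    have h2 := (h1.tendsto 0).comp (hxdiff l l.2.le)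
    have h3 := (hsub l).sub h2
    simpa [Function.comp_def, Matrix.mulVec_sub] using h3
  have hev : ∀ᶠ m in atTop, ∀ l, |(modelMatrix S *ᵥ δ₀) l - (modelMatrix S *ᵥ x (J * m)) l| < η := by
    rw [eventually_all]
    intro l
    have := (hfin l).eventually (Metric.ball_mem_nhds _ hη)
    filter_upwards [this] with m hm
    rw [abs_sub_comm]; exact hm
  obtain ⟨m, hm, hm1⟩ := (hev.and (eventually_ge_atTop 1)).exists
  -- The test is only made after an iteration, so `J * m` must be a successor, hence `m ≥ 1`.
  refine ⟨J * m - 1, fun j => ?_⟩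
  have : J * m - 1 + 1 = J * m := Nat.sub_add_cancel (Nat.mul_pos (NeZero.pos J) hm1)
  rw [this, ← hδ₀]
  exact hm j

end Fitting

/-! ### Stability of the model members with given subset sums -/

section Stability

variable {I : Type*} [Fintype I] {J : ℕ}

/-- The logarithm of the monomial with exponents `u` depends only on `A u`. For nonnegative
exponents such an identity passes to the closure of the model. -/
lemma prod_rpow_eq_of_mulVec_eq {A : Matrix (Fin J) I ℝ} {δ u v : I → ℝ}
    (hδ : δ ∈ model .intensity A) (huv : A *ᵥ u = A *ᵥ v) :
    ∏ i, δ i ^ u i = ∏ i, δ i ^ v i := by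
  obtain ⟨h0, β, hβ⟩ := hδ
  have h : ∀ w : I → ℝ, ∏ i, δ i ^ w i = Real.exp (∑ i, w i * Real.log (δ i)) := by
    intro w
    rw [Real.exp_sum]
    exact Finset.prod_congr rfl fun i _ => by rw [Real.rpow_def_of_pos (h0 i), mul_comm]
  rw [h, h, sum_log_mul_eq hβ, sum_log_mul_eq hβ, huv]

lemma continuous_prod_rpow {u : I → ℝ} (hu : ∀ i, 0 ≤ u i) :
    Continuous fun δ : I → ℝ => ∏ i, δ i ^ u i :=
  continuous_finsetProd _ fun i _ => (continuous_apply i).rpow_const fun _ => Or.inr (hu i)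

/-- A limit of members of the model that has the subset sums of a member is that member. -/
lemma eq_of_clusterPt_model {A : Matrix (Fin J) I ℝ} {p x : I → ℝ}
    (hp : p ∈ model .intensity A) (hx : x ∈ closure (model .intensity A))
    (h : A *ᵥ x = A *ᵥ p) : x = p := by
  have hx0 : ∀ i, 0 ≤ x i := by
    have : closure (model .intensity A) ⊆ {δ : I → ℝ | ∀ i, 0 ≤ δ i} := by
      refine closure_minimal (fun δ hδ i => (hδ.1 i).le) ?_
      simp only [Set.ofPred_forall]
      exact isClosed_iInter fun i => isClosed_le continuous_const (continuous_apply i)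
    exact this hx
  -- Positive and negative parts of the kernel vector `p - x`: both are nonnegative exponents.
  set u : I → ℝ := fun i => max (p i - x i) 0 with hu
  set v : I → ℝ := fun i => max (x i - p i) 0 with hv
  have huv : u - v = p - x := by
    funext i
    simp only [hu, hv, Pi.sub_apply]
    rcases le_total (p i) (x i) with hi | hi
    · rw [max_eq_right (by linarith), max_eq_left (by linarith)]; ring
    · rw [max_eq_left (by linarith), max_eq_right (by linarith)]; ring
  have hAuv : A *ᵥ u = A *ᵥ v := by
    rw [← sub_eq_zero, ← Matrix.mulVec_sub, huv, Matrix.mulVec_sub, h, sub_self]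
  have hprod : ∏ i, x i ^ u i = ∏ i, x i ^ v i := by
    have : closure (model .intensity A) ⊆ {δ : I → ℝ | ∏ i, δ i ^ u i = ∏ i, δ i ^ v i} :=
      closure_minimal (fun δ hδ => prod_rpow_eq_of_mulVec_eq hδ hAuv)
        (isClosed_eq (continuous_prod_rpow fun i => le_max_right _ _)
          (continuous_prod_rpow fun i => le_max_right _ _))
    exact this hx
  -- Where `x i = 0`, the exponent `v i` is zero and `0 ^ 0 = 1`, whereas `u i = p i > 0` would make
  -- the left product vanish. So `x` has no zero cell.
  have hright : 0 < ∏ i, x i ^ v i := by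
    refine Finset.prod_pos fun i _ => ?_
    rcases (hx0 i).eq_or_lt with hi | hi
    · have : v i = 0 := by simp only [hv, ← hi]; exact max_eq_right (by linarith [hp.1 i])
      rw [this, Real.rpow_zero]; exact one_pos
    · exact Real.rpow_pos_of_pos hi _
  have hxpos : ∀ i, 0 < x i := by
    intro i
    refine (hx0 i).lt_of_ne fun hi => ?_
    have hui : u i ≠ 0 := by
      simp only [hu, ← hi, sub_zero, max_eq_left (hp.1 i).le]; exact (hp.1 i).ne'
    have : ∏ i, x i ^ u i = 0 :=
      Finset.prod_eq_zero (Finset.mem_univ i) (by rw [← hi, Real.zero_rpow hui])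
    rw [hprod] at this
    exact hright.ne' this
  have hlog : ∀ w : I → ℝ, Real.log (∏ i, x i ^ w i) = ∑ i, w i * Real.log (x i) := by
    intro w
    rw [Real.log_prod fun i _ => (Real.rpow_pos_of_pos (hxpos i) _).ne']
    exact Finset.sum_congr rfl fun i _ => Real.log_rpow (hxpos i) _
  have h1 : ∑ i, (p i - x i) * Real.log (x i) = 0 := by
    have h2 := congrArg Real.log hprod
    rw [hlog, hlog, ← sub_eq_zero, ← Finset.sum_sub_distrib] at h2
    rw [← h2]
    refine Finset.sum_congr rfl fun i _ => ?_
    rw [← sub_mul, ← Pi.sub_apply u v, huv]; rfl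
  have h3 : ∑ i, (p i - x i) * Real.log (p i) = 0 := by
    obtain ⟨_, β, hβ⟩ := hp
    have := sum_log_mul_eq hβ (p - x)
    rw [Matrix.mulVec_sub, h, sub_self] at this
    simpa using this
  -- By monotonicity of `log` every term is nonnegative, so each vanishes and `p i = x i`.
  have h4 : ∑ i, (p i - x i) * (Real.log (p i) - Real.log (x i)) = 0 := by
    simp only [mul_sub, Finset.sum_sub_distrib] at h1 h3 ⊢
    linarith
  have hnn : ∀ i, 0 ≤ (p i - x i) * (Real.log (p i) - Real.log (x i)) := by
    intro i
    rcases le_total (p i) (x i) with hi | hi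
    · exact mul_nonneg_of_nonpos_of_nonpos (by linarith)
        (by linarith [Real.log_le_log (hp.1 i) hi])
    · exact mul_nonneg (by linarith) (by linarith [Real.log_le_log (hxpos i) hi])
  funext i
  have h5 := (Finset.sum_eq_zero_iff_of_nonneg fun i _ => hnn i).1 h4 i (Finset.mem_univ i)
  rcases mul_eq_zero.1 h5 with h6 | h6
  · linarith
  · exact (Real.log_injOn_pos (hp.1 i) (hxpos i) (sub_eq_zero.1 h6)).symm

/-- The filter describes model members whose subset sums approach those of `p`. Covering bounds each
cell by a subset sum, so they stay in a compact box, and `eq_of_clusterPt_model` leaves `p` as the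
only cluster point. -/
theorem tendsto_model_of_mulVec [DecidableEq I] {S : Fin J → Finset I}
    (hcov : ∀ i, ∃ j, i ∈ S j) {p : I → ℝ} (hp : p ∈ model .intensity (modelMatrix S)) :
    Tendsto id (comap (modelMatrix S *ᵥ ·) (𝓝 (modelMatrix S *ᵥ p)) ⊓
      𝓟 (model .intensity (modelMatrix S))) (𝓝 p) := by
  set A := modelMatrix S with hA
  set l := comap (A *ᵥ ·) (𝓝 (A *ᵥ p)) ⊓ 𝓟 (model .intensity A) with hl
  have hAl : Tendsto (A *ᵥ ·) l (𝓝 (A *ᵥ p)) := tendsto_comap.mono_left inf_le_left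
  have hml : ∀ᶠ δ in l, δ ∈ model .intensity A :=
    mem_inf_of_right (mem_principal_self _)
  have hcont : Continuous (A *ᵥ · : (I → ℝ) → Fin J → ℝ) :=
    (Matrix.mulVecLin A).continuous_of_finiteDimensional
  have hbox : ∀ᶠ δ in l, ∀ j, (A *ᵥ δ) j < (A *ᵥ p) j + 1 := by
    rw [eventually_all]
    intro j
    exact ((continuous_apply j).tendsto _ |>.comp hAl).eventually_lt_const (lt_add_one _)
  choose c hc using hcov
  refine IsCompact.tendsto_nhds_of_unique_mapClusterPt
    (isCompact_Icc (a := (0 : I → ℝ)) (b := fun i => (A *ᵥ p) (c i) + 1)) ?_ ?_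
  · filter_upwards [hml, hbox] with δ h1 h2
    refine ⟨fun i => (h1.1 i).le, fun i => le_trans ?_ (h2 (c i)).le⟩
    rw [hA, modelMatrix_mulVec]
    exact Finset.single_le_sum (f := δ) (fun k _ => (h1.1 k).le) (hc i)
  · intro x _ hx
    have hx' : ClusterPt x l := by simpa [MapClusterPt] using hx
    have : NeBot (𝓝 x ⊓ l) := hx'
    refine eq_of_clusterPt_model hp ?_ ?_
    · exact mem_closure_iff_clusterPt.2 (hx'.mono inf_le_right)
    · exact tendsto_nhds_unique ((hcont.tendsto x).mono_left (inf_le_left (b := l)))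
        (hAl.mono_left inf_le_right)

/-- The total of a member of the model is determined, with stability, by its subset sums. -/
theorem exists_abs_sum_sub_lt [DecidableEq I] {S : Fin J → Finset I}
    (hcov : ∀ i, ∃ j, i ∈ S j) {p : I → ℝ} (hp : p ∈ model .intensity (modelMatrix S))
    {ε : ℝ} (hε : 0 < ε) :
    ∃ ρ > 0, ∀ δ ∈ model .intensity (modelMatrix S),
      (∀ j, |(modelMatrix S *ᵥ δ) j - (modelMatrix S *ᵥ p) j| < ρ) →
        |∑ i, δ i - ∑ i, p i| < ε := by
  have hsum : Continuous fun δ : I → ℝ => ∑ i, δ i := by fun_prop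
  have h := ((hsum.tendsto p).comp (tendsto_model_of_mulVec hcov hp)).eventually
    (Metric.ball_mem_nhds _ hε)
  rw [eventually_inf_principal,
    (Metric.nhds_basis_ball.comap (modelMatrix S *ᵥ ·)).eventually_iff] at h
  obtain ⟨ρ, hρ, h⟩ := h
  exact ⟨ρ, hρ, fun δ hδ hj => h ((dist_pi_lt_iff hρ).2 hj) hδ⟩

end Stability

/-! ### Likelihood equations -/

section Likelihood

variable {I : Type*} [Fintype I] {J : ℕ}

lemma log_likelihood_intensity (y : I → ℕ) {δ : I → ℝ} (hδ : ∀ i, 0 < δ i) :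
    Real.log (likelihood .intensity y δ) =
      ∑ i, (y i * Real.log (δ i) - δ i) - ∑ i, Real.log ((y i).factorial : ℝ) := by
  have hf : ∀ i, ((y i).factorial : ℝ) ≠ 0 := fun i => by positivity
  have hy : ∀ i, δ i ^ y i ≠ 0 := fun i => (pow_pos (hδ i) _).ne'
  rw [likelihood, Real.log_prod fun i _ =>
    div_ne_zero (mul_ne_zero (Real.exp_pos _).ne' (hy i)) (hf i), ← Finset.sum_sub_distrib]
  refine Finset.sum_congr rfl fun i _ => ?_
  rw [Real.log_div (mul_ne_zero (Real.exp_pos _).ne' (hy i)) (hf i),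
    Real.log_mul (Real.exp_pos _).ne' (hy i), Real.log_exp, Real.log_pow]
  ring

lemma log_likelihood_probability (y : I → ℕ) {δ : I → ℝ} (hδ : ∀ i, 0 < δ i) :
    Real.log (likelihood .probability y δ) =
      Real.log (Nat.multinomial Finset.univ y) + ∑ i, y i * Real.log (δ i) := by
  have hy : ∀ i, δ i ^ y i ≠ 0 := fun i => (pow_pos (hδ i) _).ne'
  rw [likelihood, Real.log_mul (Nat.cast_ne_zero.2 (Nat.multinomial_pos _ _).ne')
    (Finset.prod_ne_zero_iff.2 fun i _ => hy i), Real.log_prod fun i _ => hy i]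
  simp

lemma likelihood_pos (kind : Kind) (y : I → ℕ) {δ : I → ℝ} (hδ : ∀ i, 0 < δ i) :
    0 < likelihood kind y δ := by
  cases kind
  · exact Finset.prod_pos fun i _ => div_pos (mul_pos (Real.exp_pos _) (pow_pos (hδ i) _))
      (by positivity)
  · exact mul_pos (Nat.cast_pos.2 (Nat.multinomial_pos _ _))
      (Finset.prod_pos fun i _ => pow_pos (hδ i) _)

/-- The linear functional `v ↦ ∑ j, v j * c j`. -/
def weightFunctional (c : Fin J → ℝ) : (Fin J → ℝ) →L[ℝ] ℝ :=
  ∑ j, c j • ContinuousLinearMap.proj j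

lemma weightFunctional_apply (c v : Fin J → ℝ) : weightFunctional c v = ∑ j, c j * v j := by
  simp [weightFunctional]

lemma weightFunctional_mulVec (A : Matrix (Fin J) I ℝ) (u : I → ℝ) (v : Fin J → ℝ) :
    weightFunctional (A *ᵥ u) v = ∑ i, u i * (Aᵀ *ᵥ v) i := by
  rw [weightFunctional_apply, Matrix.mulVec_transpose]
  change (A *ᵥ u) ⬝ᵥ v = u ⬝ᵥ (v ᵥ* A)
  rw [dotProduct_comm, Matrix.dotProduct_mulVec, dotProduct_comm]

/-- Along the variations `δ exp (A' v)` the total is the only nonlinear part of the Poisson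
log-likelihood and is the multinomial constraint. Strictness serves the Lagrange multiplier rule. -/
lemma hasStrictFDerivAt_sum_mul_exp (A : Matrix (Fin J) I ℝ) (δ : I → ℝ) :
    HasStrictFDerivAt (fun v : Fin J → ℝ => ∑ i, δ i * Real.exp ((Aᵀ *ᵥ v) i))
      (weightFunctional (A *ᵥ δ)) 0 := by
  have h1 : ∀ i, HasStrictFDerivAt (fun v : Fin J → ℝ => δ i * Real.exp ((Aᵀ *ᵥ v) i))
      (δ i • (ContinuousLinearMap.proj i ∘L (Aᵀ).mulVecLin.toContinuousLinearMap)) 0 := by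
    intro i
    have h2 : HasStrictFDerivAt (fun v : Fin J → ℝ => (Aᵀ *ᵥ v) i)
        (ContinuousLinearMap.proj i ∘L (Aᵀ).mulVecLin.toContinuousLinearMap) 0 :=
      (ContinuousLinearMap.proj (R := ℝ) (φ := fun _ : I => ℝ) i ∘L
        (Aᵀ).mulVecLin.toContinuousLinearMap).hasStrictFDerivAt
    simpa using h2.exp.const_mul (δ i)
  refine (HasStrictFDerivAt.fun_sum fun i (_ : i ∈ Finset.univ) => h1 i).congr_fderiv ?_
  refine ContinuousLinearMap.ext fun v => ?_
  rw [weightFunctional_mulVec]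
  simp [Matrix.mulVec_transpose]

lemma mulVec_eq_of_weightFunctional_eq {c c' : Fin J → ℝ}
    (h : weightFunctional c = weightFunctional c') : c = c' := by
  funext j
  have := congrArg (fun f => f (Pi.single j 1)) h
  simpa [weightFunctional_apply, Pi.single_apply] using this

theorem IsMLE.mulVec_eq_of_intensity {A : Matrix (Fin J) I ℝ} {y : I → ℕ} {δ : I → ℝ}
    (h : IsMLE .intensity A y δ) : A *ᵥ δ = A *ᵥ (fun i => (y i : ℝ)) := by
  have h0 := h.1.1
  have hmax : IsLocalMax (fun v : Fin J → ℝ => weightFunctional (A *ᵥ (fun i => (y i : ℝ))) v -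
      ∑ i, δ i * Real.exp ((Aᵀ *ᵥ v) i)) 0 := by
    refine Eventually.of_forall fun v => ?_
    have hv := mul_exp_mem_model h.1 v
    have h1 := Real.log_le_log (likelihood_pos .intensity y hv.1) (h.2 _ hv)
    rw [log_likelihood_intensity y hv.1, log_likelihood_intensity y h0] at h1
    simp only [Real.log_mul (h0 _).ne' (Real.exp_pos _).ne', Real.log_exp, mul_add,
      Finset.sum_sub_distrib, Finset.sum_add_distrib, ← weightFunctional_mulVec] at h1
    simp only [map_zero, Matrix.mulVec_zero, Pi.zero_apply, Real.exp_zero, mul_one]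
    linarith
  have hd := hmax.hasFDerivAt_eq_zero ((weightFunctional _).hasFDerivAt.sub
    (hasStrictFDerivAt_sum_mul_exp A δ).hasFDerivAt)
  exact (mulVec_eq_of_weightFunctional_eq (sub_eq_zero.1 hd)).symm

/-- Lagrange multipliers: the linear functional of `A y` is extremal at `v = 0` among variations of
fixed total, whose gradient is `A δ`. -/
theorem IsMLE.exists_mulVec_eq_of_probability {A : Matrix (Fin J) I ℝ} {y : I → ℕ} {δ : I → ℝ}
    (h : IsMLE .probability A y δ) (hA : A *ᵥ δ ≠ 0) :
    ∃ c : ℝ, A *ᵥ (fun i => (y i : ℝ)) = c • (A *ᵥ δ) := by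
  have h0 := h.1.1.1
  have hmem : δ ∈ model .intensity A := ⟨h0, h.1.2⟩
  have hmax : IsLocalExtrOn (weightFunctional (A *ᵥ (fun i => (y i : ℝ))))
      {v | (fun v : Fin J → ℝ => ∑ i, δ i * Real.exp ((Aᵀ *ᵥ v) i)) v =
        (fun v : Fin J → ℝ => ∑ i, δ i * Real.exp ((Aᵀ *ᵥ v) i)) 0} 0 := by
    refine Or.inr ?_
    filter_upwards [self_mem_nhdsWithin] with v hv'
    have hv := mul_exp_mem_model hmem v
    have hv1 : ∑ i, δ i * Real.exp ((Aᵀ *ᵥ v) i) = 1 := by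
      refine Eq.trans hv' ?_
      simpa using h.1.1.2
    have h1 := Real.log_le_log (likelihood_pos .probability y hv.1) (h.2 _ ⟨⟨hv.1, hv1⟩, hv.2⟩)
    rw [log_likelihood_probability y hv.1, log_likelihood_probability y h0] at h1
    simp only [Real.log_mul (h0 _).ne' (Real.exp_pos _).ne', Real.log_exp, mul_add,
      Finset.sum_add_distrib, ← weightFunctional_mulVec] at h1
    rw [map_zero]
    linarith
  obtain ⟨a, b, hab, heq⟩ := hmax.exists_multipliers_of_hasStrictFDerivAt_1d
    (hasStrictFDerivAt_sum_mul_exp A δ) (weightFunctional _).hasStrictFDerivAt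
  have hj : ∀ j, a * (A *ᵥ δ) j + b * (A *ᵥ (fun i => (y i : ℝ))) j = 0 := by
    intro j
    have := congrArg (fun f => f (Pi.single j 1)) heq
    simpa [weightFunctional_apply, Pi.single_apply] using this
  -- With `b = 0`, `A δ ≠ 0` would force `a = 0` too, but the multipliers are not both zero.
  have hb : b ≠ 0 := by
    rintro rfl
    obtain ⟨j, hj'⟩ := Function.ne_iff.1 hA
    have := hj j
    simp only [zero_mul, add_zero, mul_eq_zero] at this
    exact hab (by rw [this.resolve_right hj']; rfl)
  refine ⟨-(a / b), funext fun j => ?_⟩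
  have := hj j
  simp only [Pi.smul_apply, smul_eq_mul]
  field_simp
  linarith

end Likelihood

/-! ### Termination of the search -/

lemma exists_gridPoint_near {a b c : ℝ} (hac : a ≤ c) (hcb : c ≤ b) {T : ℕ} (hT : 0 < T) :
    ∃ t ≤ T, |a + (t : ℝ) / T * (b - a) - c| ≤ (b - a) / T := by
  have hT' : (0 : ℝ) < T := Nat.cast_pos.2 hT
  rcases (hac.trans hcb).eq_or_lt with rfl | hab
  · exact ⟨0, Nat.zero_le _, by simp [le_antisymm hcb hac]⟩
  have hba : 0 < b - a := sub_pos.2 hab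
  -- The position of `c` in units of the grid spacing; its floor is the required index.
  set x : ℝ := T * ((c - a) / (b - a)) with hx
  have hx0 : 0 ≤ x := mul_nonneg hT'.le (div_nonneg (by linarith) hba.le)
  have hxT : x ≤ T := mul_le_of_le_one_right hT'.le ((div_le_one hba).2 (by linarith))
  have h1 := Nat.floor_le hx0
  have h2 := Nat.lt_floor_add_one x
  refine ⟨⌊x⌋₊, by exact_mod_cast h1.trans hxT, ?_⟩
  have h3 : a + (⌊x⌋₊ : ℝ) / T * (b - a) - c = (⌊x⌋₊ - x) * ((b - a) / T) := by
    rw [hx]; field_simp; ring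
  rw [h3, abs_mul, abs_of_pos (div_pos hba hT')]
  exact mul_le_of_le_one_left (div_pos hba hT').le (abs_le.2 ⟨by linarith, by linarith⟩)

/-- The machine with transition function `f` passes from the configuration `c` to `c'`. -/
def Reaches {α : Type*} (f : α → α) (c c' : α) : Prop := ∃ n : ℕ, f^[n] c = c'

lemma Reaches.trans {α : Type*} {f : α → α} {a b c : α} (h : Reaches f a b) (h' : Reaches f b c) :
    Reaches f a c := by
  obtain ⟨n, rfl⟩ := h
  obtain ⟨m, rfl⟩ := h'
  exact ⟨m + n, Function.iterate_add_apply _ _ _ _⟩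

/-- A machine that runs the loop `repeat s := g s until P s` completes it. -/
lemma reaches_of_loop {α β : Type*} {f : β → β} {g : α → α} {w : α → β} {P : α → Prop}
    (hstep : ∀ s, ¬ P (g s) → f (w s) = w (g s)) {s₀ : α} (h : ∃ n, P (g^[n + 1] s₀)) :
    ∃ n, P (g^[n + 1] s₀) ∧ Reaches f (w s₀) (f (w (g^[n] s₀))) := by
  classical
  -- At the first success all earlier tests have failed, so `hstep` applies up to there. The last
  -- step of `f` stays unevaluated because it leaves the loop.
  refine ⟨Nat.find h, Nat.find_spec h, Nat.find h + 1, ?_⟩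
  rw [Function.iterate_succ_apply']
  congr 1
  have : ∀ m ≤ Nat.find h, f^[m] (w s₀) = w (g^[m] s₀) := by
    intro m
    induction m with
    | zero => intro _; rfl
    | succ m ih =>
      intro hm
      rw [Function.iterate_succ_apply', ih (by omega), Function.iterate_succ_apply']
      apply hstep
      rw [← Function.iterate_succ_apply' g]
      exact Nat.find_min h hm
  exact this _ le_rfl

section Search

variable {I : Type*} [Fintype I] [DecidableEq I] {J : ℕ}
  {rel : ℝ → ℝ → Prop} {S : Fin J → Finset I} {iStar : Fin J → I} {q p : I → ℝ} {c ε : ℝ}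

/-- At some grid point every member of the model that passes the stopping test has total nearly
one. -/
lemma exists_grid_sum_near (hle : ∀ a b, rel a b → a ≤ b) (hS : ∀ j, (S j).Nonempty)
    (hcov : ∀ i, ∃ j, i ∈ S j) (hp : p ∈ model .intensity (modelMatrix S)) (hp1 : ∑ i, p i = 1)
    (hc : 0 < c) (hAp : modelMatrix S *ᵥ p = c • (modelMatrix S *ᵥ q)) (hε : 0 < ε)
    (hL : gammaL (modelMatrix S) q ≤ c) (hR : c ≤ gammaR (modelMatrix S) q) :
    ∃ T t : ℕ, 0 < T ∧ t ≤ T ∧ ∀ δ ∈ model .intensity (modelMatrix S),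
      ipfAccept rel (modelMatrix S) q (gridPoint (modelMatrix S) q T t) (ε / T) δ →
        |∑ i, δ i - 1| < ε := by
  obtain ⟨ρ, hρ, h⟩ := exists_abs_sum_sub_lt hcov hp hε
  have hq := mulVec_observed_pos hS hp.1 hc hAp
  set a := gammaL (modelMatrix S) q with ha
  set b := gammaR (modelMatrix S) q with hb
  set Q := ∑ j, (modelMatrix S *ᵥ q) j
  have hQ : ∀ j, (modelMatrix S *ᵥ q) j ≤ Q := fun j =>
    Finset.single_le_sum (fun k _ => (hq k).le) (Finset.mem_univ j)
  -- `ε / T` bounds the error of the stopping test and `(b - a) / T * Q` that of the grid; the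
  -- maximum with `0` makes `T` positive.
  obtain ⟨T, hT⟩ := exists_nat_gt (max 0 ((ε + (b - a) * Q) / ρ))
  have hT0 : (0 : ℝ) < T := (le_max_left _ _).trans_lt hT
  have hTρ : (ε + (b - a) * Q) / T < ρ := by
    rw [div_lt_iff₀ hT0, mul_comm ρ, ← div_lt_iff₀ hρ]
    exact (le_max_right _ _).trans_lt hT
  have hTn : 0 < T := Nat.cast_pos.1 hT0
  obtain ⟨t, htT, ht⟩ := exists_gridPoint_near hL hR hTn
  refine ⟨T, t, hTn, htT, fun δ hδ hacc => ?_⟩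
  rw [← hp1]
  refine h δ hδ fun j => lt_of_le_of_lt ?_ hTρ
  have h1 := hle _ _ (hacc j)
  rw [hAp, Pi.smul_apply, smul_eq_mul]
  set γ := gridPoint (modelMatrix S) q T t with hγ
  have h2 : |(γ - c) * (modelMatrix S *ᵥ q) j| ≤ (b - a) / T * Q := by
    rw [abs_mul, abs_of_pos (hq j)]
    exact mul_le_mul ht (hQ j) (hq j).le ((abs_nonneg _).trans ht)
  have h3 : (modelMatrix S *ᵥ δ) j - c * (modelMatrix S *ᵥ q) j =
      -(γ * (modelMatrix S *ᵥ q) j - (modelMatrix S *ᵥ δ) j) +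
        (γ - c) * (modelMatrix S *ᵥ q) j := by ring
  rw [h3]
  refine (abs_add_le _ _).trans ?_
  rw [abs_neg, add_div, mul_div_right_comm]
  exact add_le_add h1 h2

variable [NeZero J]

/-- The target of IPF is `(γ / c) • p`, which has subset sums `γ A q`. -/
lemma exists_ipf_accepts (hlt : ∀ a b, a < b → rel a b) (hS : ∀ j, (S j).Nonempty)
    (hp : ∀ i, 0 < p i) (hc : 0 < c) (hAp : modelMatrix S *ᵥ p = c • (modelMatrix S *ᵥ q))
    {γ η : ℝ} (hγ : 0 < γ) (hη : 0 < η) (iStar : Fin J → I) :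
    ∃ n, ipfAccept rel (modelMatrix S) q γ η
      ((ipfIterate (modelMatrix S) iStar q γ)^[n + 1] (ipfInit I J)).δ := by
  obtain ⟨n, hn⟩ := ipf_accepts (q := q) (δ₀ := (γ / c) • p) (γ := γ) hS iStar hη
    (fun i => mul_pos (div_pos hγ hc) (hp i)) (fun j => by
      rw [Matrix.mulVec_smul, hAp, smul_smul, div_mul_cancel₀ _ hc.ne']; rfl)
  exact ⟨n, fun j => hlt _ _ (hn j)⟩

/-- The outputs that the theorem allows, for the tolerance relation `rel`. -/
def IsAdmissibleOutput (rel : ℝ → ℝ → Prop) (kind : Kind) (A : Matrix (Fin J) I ℝ) (q : I → ℝ)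
    (ε : ℝ) (δ : I → ℝ) (γ : ℝ) : Prop :=
  δ ∈ model .intensity A ∧ ipfAccept rel A q γ ε δ ∧
    (kind = Kind.probability → |∑ i, δ i - 1| < ε)

lemma reaches_of_initial (hlt : ∀ a b, a < b → rel a b) (hS : ∀ j, (S j).Nonempty)
    (hp : ∀ i, 0 < p i) (hc : 0 < c) (hAp : modelMatrix S *ᵥ p = c • (modelMatrix S *ᵥ q))
    (kind : Kind) (hε : 0 < ε) :
    (∃ δ γ, Reaches (gipfStep rel kind (modelMatrix S) iStar q ε) (.initial (ipfInit I J))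
        (.finished δ γ) ∧ IsAdmissibleOutput rel kind (modelMatrix S) q ε δ γ) ∨
      kind = .probability ∧ Reaches (gipfStep rel kind (modelMatrix S) iStar q ε)
        (.initial (ipfInit I J)) (.grid 1 0 (ipfInit I J)) := by
  obtain ⟨n, hn, hr⟩ := reaches_of_loop (f := gipfStep rel kind (modelMatrix S) iStar q ε)
    (g := ipfIterate (modelMatrix S) iStar q 1) (w := .initial)
    (P := fun s => ipfAccept rel (modelMatrix S) q 1 ε s.δ)
    (fun s hs => by simp only [gipfStep, if_neg hs])
    (exists_ipf_accepts hlt hS hp hc hAp one_pos hε iStar)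
  have hmem := ipfIterate_iterate_mem_model (γ := 1) hS iStar
    (fun j => by simpa using mulVec_observed_pos hS hp hc hAp j) (n + 1)
  rw [Function.iterate_succ_apply'] at hn hmem
  set s := (ipfIterate (modelMatrix S) iStar q 1)^[n] (ipfInit I J)
  simp only [gipfStep, if_pos hn] at hr
  cases kind with
  | intensity => exact Or.inl ⟨_, _, hr, hmem, hn, by simp⟩
  | probability =>
    dsimp only at hr
    split_ifs at hr with hsum
    · exact Or.inl ⟨_, _, hr, hmem, hn, fun _ => hsum⟩
    · exact Or.inr ⟨rfl, hr⟩

/-- An unsuccessful call leaves a witness, an accepted model member with a bad total, which a good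
grid point rules out. -/
lemma reaches_of_grid (hlt : ∀ a b, a < b → rel a b)
    (hmono : ∀ a b c, rel a b → b ≤ c → rel a c) (hS : ∀ j, (S j).Nonempty)
    (hp : ∀ i, 0 < p i) (hc : 0 < c) (hAp : modelMatrix S *ᵥ p = c • (modelMatrix S *ᵥ q))
    (kind : Kind) (hε : 0 < ε) {T t : ℕ} (hT : 0 < T)
    (hγ : 0 < gridPoint (modelMatrix S) q T t) :
    (∃ δ γ, Reaches (gipfStep rel kind (modelMatrix S) iStar q ε) (.grid T t (ipfInit I J))
        (.finished δ γ) ∧ IsAdmissibleOutput rel kind (modelMatrix S) q ε δ γ) ∨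
      (∃ δ ∈ model .intensity (modelMatrix S),
        ipfAccept rel (modelMatrix S) q (gridPoint (modelMatrix S) q T t) (ε / T) δ ∧
          ¬ |∑ i, δ i - 1| < ε) ∧
      Reaches (gipfStep rel kind (modelMatrix S) iStar q ε) (.grid T t (ipfInit I J))
        (if t < T then .grid T (t + 1) (ipfInit I J) else .grid (T + 1) 0 (ipfInit I J)) := by
  have hT' : (1 : ℝ) ≤ T := Nat.one_le_cast.2 hT
  obtain ⟨n, hn, hr⟩ := reaches_of_loop (f := gipfStep rel kind (modelMatrix S) iStar q ε)
    (g := ipfIterate (modelMatrix S) iStar q (gridPoint (modelMatrix S) q T t)) (w := .grid T t)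
    (P := fun s => ipfAccept rel (modelMatrix S) q (gridPoint (modelMatrix S) q T t) (ε / T) s.δ)
    (fun s hs => by simp only [gipfStep, if_neg hs])
    (exists_ipf_accepts hlt hS hp hc hAp hγ (div_pos hε (by linarith)) iStar)
  have hmem := ipfIterate_iterate_mem_model hS iStar
    (fun j => mul_pos hγ (mulVec_observed_pos hS hp hc hAp j)) (n + 1)
  rw [Function.iterate_succ_apply'] at hn hmem
  set s := (ipfIterate (modelMatrix S) iStar q (gridPoint (modelMatrix S) q T t))^[n]
    (ipfInit I J)
  simp only [gipfStep, if_pos hn] at hr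
  by_cases hsum : |∑ i, (ipfIterate (modelMatrix S) iStar q
      (gridPoint (modelMatrix S) q T t) s).δ i - 1| < ε
  · rw [if_pos hsum] at hr
    exact Or.inl ⟨_, _, hr, hmem,
      fun j => hmono _ _ _ (hn j) (div_le_self hε.le hT'), fun _ => hsum⟩
  · rw [if_neg hsum] at hr
    refine Or.inr ⟨⟨_, hmem, hn, hsum⟩, ?_⟩
    convert hr

lemma gammaL_pos (hq : ∀ j, 0 < (modelMatrix S *ᵥ q) j) : 0 < gammaL (modelMatrix S) q :=
  inv_pos.2 (Finset.sum_pos (fun j _ => hq j) Finset.univ_nonempty)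

lemma gammaL_le (hq : ∀ j, 0 < (modelMatrix S *ᵥ q) j) (hcov : ∀ i, ∃ j, i ∈ S j)
    (hp : ∀ i, 0 < p i) (hp1 : ∑ i, p i = 1)
    (hAp : modelMatrix S *ᵥ p = c • (modelMatrix S *ᵥ q)) : gammaL (modelMatrix S) q ≤ c := by
  have h1 : (1 : ℝ) ≤ ∑ j, (modelMatrix S *ᵥ p) j := by
    simp only [modelMatrix_mulVec]
    -- Charging each cell to one subset containing it bounds the total by the sum of the subset
    -- sums.
    choose f hf using hcov
    rw [← hp1, ← Finset.sum_fiberwise Finset.univ f p]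
    exact Finset.sum_le_sum fun j _ => Finset.sum_le_sum_of_subset_of_nonneg
      (fun i hi => (Finset.mem_filter.1 hi).2 ▸ hf i) fun i _ _ => (hp i).le
  rw [hAp] at h1
  simp only [Pi.smul_apply, smul_eq_mul, ← Finset.mul_sum] at h1
  have hQ : 0 < ∑ j, (modelMatrix S *ᵥ q) j :=
    Finset.sum_pos (fun j _ => hq j) Finset.univ_nonempty
  rw [gammaL, inv_le_iff_one_le_mul₀ hQ]
  exact h1

lemma le_gammaR (hq : ∀ j, 0 < (modelMatrix S *ᵥ q) j)
    (hp : ∀ i, 0 < p i) (hp1 : ∑ i, p i = 1)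
    (hAp : modelMatrix S *ᵥ p = c • (modelMatrix S *ᵥ q)) : c ≤ gammaR (modelMatrix S) q := by
  refine le_ciInf fun j => ?_
  rw [le_div_iff₀ (hq j)]
  have h1 : (modelMatrix S *ᵥ p) j ≤ 1 := by
    rw [modelMatrix_mulVec, ← hp1]
    exact Finset.sum_le_univ_sum_of_nonneg fun i => (hp i).le
  rwa [hAp] at h1

/-- Without an admissible output every grid configuration would be reached, including the one from
`exists_grid_sum_near`. The three conditions on `rel` are shared by `<` and `≤`, so both stopping
tests are covered. -/
theorem gipf_terminates (hlt : ∀ a b, a < b → rel a b) (hle : ∀ a b, rel a b → a ≤ b)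
    (hmono : ∀ a b c, rel a b → b ≤ c → rel a c) (hS : ∀ j, (S j).Nonempty)
    (hp : p ∈ model .intensity (modelMatrix S)) (hc : 0 < c)
    (hAp : modelMatrix S *ᵥ p = c • (modelMatrix S *ᵥ q)) (kind : Kind)
    (hprob : kind = .probability → ∑ i, p i = 1 ∧ ∀ i, ∃ j, i ∈ S j) (hε : 0 < ε) :
    ∃ δ γ, GIPFReturns rel kind (modelMatrix S) iStar q ε δ γ ∧
      IsAdmissibleOutput rel kind (modelMatrix S) q ε δ γ := by
  rcases reaches_of_initial (iStar := iStar) hlt hS hp.1 hc hAp kind hε with h | ⟨hk, hr⟩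
  · exact h
  obtain ⟨hp1, hcov⟩ := hprob hk
  have hq := mulVec_observed_pos hS hp.1 hc hAp
  have hL := gammaL_le hq hcov hp.1 hp1 hAp
  have hR := le_gammaR hq hp.1 hp1 hAp
  have hγ : ∀ T t, 0 < gridPoint (modelMatrix S) q T t := fun T t =>
    add_pos_of_pos_of_nonneg (gammaL_pos hq) (mul_nonneg (by positivity) (by linarith))
  by_contra hcon
  have hcon' : ∀ {C}, Reaches (gipfStep rel kind (modelMatrix S) iStar q ε)
      (.initial (ipfInit I J)) C → ¬ ∃ δ γ, Reaches (gipfStep rel kind (modelMatrix S) iStar q ε)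
        C (.finished δ γ) ∧ IsAdmissibleOutput rel kind (modelMatrix S) q ε δ γ := by
    rintro C hC ⟨δ, γ, h1, h2⟩
    exact hcon ⟨δ, γ, hC.trans h1, h2⟩
  have hgrid : ∀ T, ∀ t ≤ T + 1, Reaches (gipfStep rel kind (modelMatrix S) iStar q ε)
      (.initial (ipfInit I J)) (.grid (T + 1) 0 (ipfInit I J)) →
      Reaches (gipfStep rel kind (modelMatrix S) iStar q ε)
        (.initial (ipfInit I J)) (.grid (T + 1) t (ipfInit I J)) := by
    intro T t ht h0
    induction t with
    | zero => exact h0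
    | succ t ih =>
      have ih := ih (by omega)
      have := ((reaches_of_grid hlt hmono hS hp.1 hc hAp kind hε T.succ_pos
        (hγ _ t)).resolve_left (hcon' ih)).2
      rw [if_pos (by omega)] at this
      exact ih.trans this
  have hrow : ∀ T, Reaches (gipfStep rel kind (modelMatrix S) iStar q ε)
      (.initial (ipfInit I J)) (.grid (T + 1) 0 (ipfInit I J)) := by
    intro T
    induction T with
    | zero => exact hr
    | succ T ih =>
      have ih := hgrid T (T + 1) le_rfl ih
      have := ((reaches_of_grid hlt hmono hS hp.1 hc hAp kind hε T.succ_pos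
        (hγ _ (T + 1))).resolve_left (hcon' ih)).2
      rw [if_neg (lt_irrefl _)] at this
      exact ih.trans this
  obtain ⟨T, t, hT, ht, hgood⟩ := exists_grid_sum_near hle hS hcov hp hp1 hc hAp hε hL hR
  obtain ⟨T, rfl⟩ := Nat.exists_eq_succ_of_ne_zero hT.ne'
  obtain ⟨δ, hδ, hacc, hsum⟩ := ((reaches_of_grid hlt hmono hS hp.1 hc hAp kind hε hT
    (hγ _ t)).resolve_left (hcon' (hgrid T t ht (hrow T)))).1
  exact hsum (hgood δ hδ hacc)

/-- Existence of an MLE provides a member of the model whose subset sums are proportional to the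
observed ones. -/
theorem IsMLE.exists_proportional {kind : Kind} {y : I → ℕ} (hy : y ≠ 0)
    (hS : ∀ j, (S j).Nonempty) {δ : I → ℝ} (h : IsMLE kind (modelMatrix S) y δ) :
    δ ∈ model .intensity (modelMatrix S) ∧
      (∃ c : ℝ, 0 < c ∧ modelMatrix S *ᵥ δ = c • (modelMatrix S *ᵥ observed kind y)) ∧
      (kind = .probability → ∑ i, δ i = 1 ∧ ∀ i, ∃ j, i ∈ S j) := by
  cases kind with
  | intensity =>
    exact ⟨h.1, ⟨1, one_pos, by rw [one_smul]; exact h.mulVec_eq_of_intensity⟩, by simp⟩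
  | probability =>
    have hδ := h.1.1.1
    have h1 := h.1.1.2
    have hpos := modelMatrix_mulVec_pos hS hδ
    obtain ⟨i₀, hi₀⟩ := Function.ne_iff.1 hy
    have hi₀' : (0 : ℝ) < y i₀ := Nat.cast_pos.2 (Nat.pos_of_ne_zero hi₀)
    -- An uncovered cell has `log δ i = 0`, so `δ i = 1` exhausts the total, yet `S 0` holds another
    -- cell of positive probability.
    have hcov : ∀ i, ∃ j, i ∈ S j := by
      intro i
      by_contra! hi
      obtain ⟨β, hβ⟩ := h.1.2
      have h2 : Real.log (δ i) = 0 := by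
        rw [congrFun hβ i]
        simp [Matrix.mulVec, dotProduct, modelMatrix, hi]
      have h3 : δ i = 1 := Real.eq_one_of_pos_of_log_eq_zero (hδ i) h2
      obtain ⟨k, hk⟩ := hS 0
      have hki : k ≠ i := fun e => hi 0 (e ▸ hk)
      have h4 : δ i + δ k ≤ ∑ i, δ i := by
        rw [← Finset.sum_pair hki.symm]
        exact Finset.sum_le_univ_sum_of_nonneg fun i => (hδ i).le
      linarith [hδ k]
    obtain ⟨c, hc⟩ := h.exists_mulVec_eq_of_probability
      (fun h0 => (hpos 0).ne' (congrFun h0 0))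
    have hN : 0 < ∑ k, (y k : ℝ) :=
      hi₀'.trans_le (Finset.single_le_sum (f := fun k => (y k : ℝ))
        (fun k _ => Nat.cast_nonneg _) (Finset.mem_univ i₀))
    have hc0 : 0 < c := by
      obtain ⟨j, hj⟩ := hcov i₀
      have h2 : 0 < (modelMatrix S *ᵥ fun i => (y i : ℝ)) j := by
        rw [modelMatrix_mulVec]
        exact hi₀'.trans_le (Finset.single_le_sum (f := fun k => (y k : ℝ))
          (fun k _ => Nat.cast_nonneg _) hj)
      rw [hc] at h2
      exact pos_of_mul_pos_left h2 (hpos j).le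
    -- Here `A y = c A δ` and `q = y / N`, so the constant sought is `N / c`.
    refine ⟨⟨hδ, h.1.2⟩, ⟨(∑ k, (y k : ℝ)) / c, div_pos hN hc0, ?_⟩, fun _ => ⟨h1, hcov⟩⟩
    have hobs : observed .probability y = (∑ k, (y k : ℝ))⁻¹ • fun i => (y i : ℝ) := by
      funext i
      simp [observed, div_eq_inv_mul]
    rw [hobs, Matrix.mulVec_smul, hc, smul_smul, smul_smul]
    have : (∑ k, (y k : ℝ)) / c * ((∑ k, (y k : ℝ))⁻¹ * c) = 1 := by field_simp
    rw [← mul_assoc] at this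
    rw [this, one_smul]

end Search

end RelationalModel

end

theorem mainTheorem3 {I : Type*} [Fintype I] [DecidableEq I] {J : ℕ} [NeZero J]
    (kind : RelationalModel.Kind)
    (S : Fin J → Finset I)
    (iStar : Fin J → I) (hStar : ∀ j, iStar j ∈ S j)
    {k : ℕ} (D : Matrix (Fin k) I ℤ)
    (hD : RelationalModel.IsKernelBasisMatrix D (RelationalModel.modelMatrix S))
    (y : I → ℕ) (hy : y ≠ 0)
    (hMLE : ∃! δ : I → ℝ, RelationalModel.IsMLE kind (RelationalModel.modelMatrix S) y δ)
    (ε : ℝ) (hε : 0 < ε) :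
    (∃ (δ : I → ℝ) (γ : ℝ),
      RelationalModel.GIPFReturns (· < ·) kind (RelationalModel.modelMatrix S) iStar
        (RelationalModel.observed kind y) ε δ γ ∧
      (∀ j, |(RelationalModel.modelMatrix S *ᵥ δ) j
        - γ * (RelationalModel.modelMatrix S *ᵥ RelationalModel.observed kind y) j| < ε) ∧
      (∀ i, 0 < δ i) ∧
      D.map (Int.cast : ℤ → ℝ) *ᵥ (fun i => Real.log (δ i)) = 0 ∧
      (kind = RelationalModel.Kind.probability → |∑ i, δ i - 1| < ε)) ∧
    (∃ (δ : I → ℝ) (γ : ℝ),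
      RelationalModel.GIPFReturns (· ≤ ·) kind (RelationalModel.modelMatrix S) iStar
        (RelationalModel.observed kind y) ε δ γ ∧
      (∀ j, |(RelationalModel.modelMatrix S *ᵥ δ) j
        - γ * (RelationalModel.modelMatrix S *ᵥ RelationalModel.observed kind y) j| ≤ ε) ∧
      (∀ i, 0 < δ i) ∧
      D.map (Int.cast : ℤ → ℝ) *ᵥ (fun i => Real.log (δ i)) = 0 ∧
      (kind = RelationalModel.Kind.probability → |∑ i, δ i - 1| < ε)) := by
  obtain ⟨δ₀, hδ₀, -⟩ := hMLE
  have hS : ∀ j, (S j).Nonempty := fun j => ⟨_, hStar j⟩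
  obtain ⟨hmem, ⟨c, hc, hAc⟩, hprob⟩ := hδ₀.exists_proportional hy hS
  constructor
  · obtain ⟨δ, γ, hret, hδ, hacc, hsum⟩ := RelationalModel.gipf_terminates (rel := (· < ·))
      (iStar := iStar) (fun _ _ h => h) (fun _ _ h => h.le) (fun _ _ _ h h' => h.trans_le h')
      hS hmem hc hAc kind hprob hε
    exact ⟨δ, γ, hret, fun j => by rw [abs_sub_comm]; exact hacc j, hδ.1,
      RelationalModel.kernel_log_eq_zero hD hδ, hsum⟩
  · obtain ⟨δ, γ, hret, hδ, hacc, hsum⟩ := RelationalModel.gipf_terminates (rel := (· ≤ ·))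
      (iStar := iStar) (fun _ _ h => h.le) (fun _ _ h => h) (fun _ _ _ h h' => h.trans h')
      hS hmem hc hAc kind hprob hε
    exact ⟨δ, γ, hret, fun j => by rw [abs_sub_comm]; exact hacc j, hδ.1,
      RelationalModel.kernel_log_eq_zero hD hδ, hsum⟩
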